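/- Let $s_1=a_1+a_2+a_3$, $s_2=a_1a_2+a_1a_3+a_2a_3$, $s_3=a_1a_2a_3$, and let $Q(a_1,a_2,a_3)$ be the symmetric polynomial of degree $12$ $$ \begin{aligned} Q={}&(2s_1+4s_3-1)\bigl(64s_1^5-64s_1^4+8s_1^3+12s_1^2-6s_1+1+240s_3s_1^2-240s_3s_1-1536s_3^2s_1-4096s_3^3+60s_3+768s_3^2\bigr)\\ &-8s_1(2s_1+4s_3-1)(2s_1-32s_3-1)(10s_1+32s_3-5)s_2\\ &-16s_1^2(13-52s_1+640s_3s_1+1024s_3^2-320s_3+52s_1^2)s_2^2\\ &+64(2s_1-1)(2s_1-32s_3-1)s_2^3+2048s_1(2s_1-1)s_2^4 . \end{aligned} $$ Let $\Omega=\{(a_1,a_2,a_3)\in\mathbb{R}^3 : Q(a_1,a_2,a_3)=0\}$. Then, with respect to the standard topology of $\mathbb{R}^3$: 1. the set $(0,1/2]^3\cap\Omega$ is connected; 2. the set $(0,1/2]^3\setminus\Omega$ has exactly three connected components. -/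

import Mathlib

/-- The defining polynomial, in terms of the values `s₁, s₂, s₃` of the elementary
symmetric polynomials of `(a₁, a₂, a₃)`. -/
def ricciQSymm (s₁ s₂ s₃ : ℝ) : ℝ :=
  (2 * s₁ + 4 * s₃ - 1) *
      (64 * s₁ ^ 5 - 64 * s₁ ^ 4 + 8 * s₁ ^ 3 + 12 * s₁ ^ 2 - 6 * s₁ + 1
        + 240 * s₃ * s₁ ^ 2 - 240 * s₃ * s₁ - 1536 * s₃ ^ 2 * s₁ - 4096 * s₃ ^ 3
        + 60 * s₃ + 768 * s₃ ^ 2)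
    - 8 * s₁ * (2 * s₁ + 4 * s₃ - 1) * (2 * s₁ - 32 * s₃ - 1)
        * (10 * s₁ + 32 * s₃ - 5) * s₂
    - 16 * s₁ ^ 2 * (13 - 52 * s₁ + 640 * s₃ * s₁ + 1024 * s₃ ^ 2 - 320 * s₃
        + 52 * s₁ ^ 2) * s₂ ^ 2
    + 64 * (2 * s₁ - 1) * (2 * s₁ - 32 * s₃ - 1) * s₂ ^ 3
    + 2048 * s₁ * (2 * s₁ - 1) * s₂ ^ 4

/-- The symmetric polynomial `Q(a₁, a₂, a₃)` of degree 12. -/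
def ricciQ (a₁ a₂ a₃ : ℝ) : ℝ :=
  ricciQSymm (a₁ + a₂ + a₃) (a₁ * a₂ + a₁ * a₃ + a₂ * a₃) (a₁ * a₂ * a₃)

/-- The real algebraic surface `Ω = {Q = 0}` in `ℝ³`. -/
def ricciOmega : Set (Fin 3 → ℝ) :=
  {a | ricciQ (a 0) (a 1) (a 2) = 0}

/-- The half-open cube `(0, 1/2]³` in `ℝ³`. -/
def halfOpenCube : Set (Fin 3 → ℝ) :=
  {a | ∀ i, a i ∈ Set.Ioc (0 : ℝ) (1 / 2)}

/-! Up to a negative constant, `ricciQ` is the discriminant of a cubic in `t`, namely `8 (a + b + c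
- 2) t (t + 1)` minus a product of three factors affine in `(a, b, c)`. For `0 < c ≤ b ≤ a` its
outer coefficients are nonnegative, and Q ≥ 0 exactly when the cubic is nonnegative for all `t > 0`.
Inequalities between `(a, b, c)`-polynomials at fixed `t` therefore replace any study of the surface
itself.

Two monotonicity facts follow. On a ray leaving the diagonal orthogonally, the coordinate sum is
fixed and the product is log-concave, so once Q ≥ 0 it is strictly positive further out
(`ricciQ_pos_of_lt`). On a segment from a point of the cube to (1/4, 1/4, 1/4), Q ≥ 0 is preserved
(`ricciQ_nonneg_toward_quarter`). On the positive diagonal Q < 0 except at that point, where Q = 0.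

Hence each negative point retracts to the diagonal, and the plane of mean 1/4, where Q ≥ 0, splits
the negative set in two. Positive points are pushed to a punctured disc in that plane. Each zero is
joined to the centre by an arc of zeros. -/

/-- The cubic whose discriminant cuts out the surface, in the scaled coordinates `a = 4 a₁` etc. -/
def pencil (a b c t : ℝ) : ℝ :=
  8 * (a + b + c - 2) * t * (t + 1)
    - (t * (a + c) + (b + c)) * (t * (a + c) - (b - c)) * ((b + c) - t * (a - c))

/-- The coefficients of `pencil`. -/
def pencilCubic (a b c : ℝ) : Cubic ℝ where
  a := (a - c) * (a + c) ^ 2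
  b := 8 * (a + b + c - 2) - (a + c) * (a * b - a * c + b * c + 3 * c ^ 2)
  c := 8 * (a + b + c - 2) - (b + c) * (a * b + a * c - b * c + 3 * c ^ 2)
  d := (b - c) * (b + c) ^ 2

theorem pencil_eq (a b c t : ℝ) : pencil a b c t =
    (pencilCubic a b c).a * t ^ 3 + (pencilCubic a b c).b * t ^ 2 + (pencilCubic a b c).c * t
      + (pencilCubic a b c).d := by
  simp only [pencil, pencilCubic]; ring

theorem ricciQ_eq_discr (a b c : ℝ) :
    ricciQ a b c = -(pencilCubic (4 * a) (4 * b) (4 * c)).discr / 65536 := by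
  simp only [ricciQ, ricciQSymm, pencilCubic, Cubic.discr]; ring

/-! ### Sign of the discriminant of a real cubic from its values on the positive axis -/

theorem exists_nonpos_root {α β γ δ : ℝ} (hα : 0 < α) (hδ : 0 ≤ δ) :
    ∃ r ≤ 0, α * r ^ 3 + β * r ^ 2 + γ * r + δ = 0 := by
  set M := (|β| + |γ| + δ) / α + 1 with hM
  have hM1 : 1 ≤ M := by
    have : 0 ≤ (|β| + |γ| + δ) / α := by positivity
    linarith
  have hαM : α * M = |β| + |γ| + δ + α := by rw [hM]; field_simp
  have hcont : ContinuousOn (fun t : ℝ => α * t ^ 3 + β * t ^ 2 + γ * t + δ) (Set.Icc (-M) 0) := by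
    fun_prop
  have hneg : α * (-M) ^ 3 + β * (-M) ^ 2 + γ * (-M) + δ ≤ 0 := by
    have h1 : α * M * M ^ 2 = (|β| + |γ| + δ + α) * M ^ 2 := by rw [hαM]
    have h2 : β * M ^ 2 ≤ |β| * M ^ 2 := by gcongr; exact le_abs_self β
    have h3 : -γ * M ≤ |γ| * M ^ 2 := by
      calc -γ * M ≤ |γ| * M := by gcongr; exact neg_le_abs γ
        _ ≤ |γ| * M ^ 2 := by gcongr; nlinarith
    have h4 : δ * 1 ≤ δ * M ^ 2 := by gcongr; nlinarith
    have h5 : 0 ≤ α * M ^ 2 := by positivity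
    nlinarith
  obtain ⟨r, hr, hr0⟩ := intermediate_value_Icc (by linarith : -M ≤ 0) hcont
    (show (0 : ℝ) ∈ _ from ⟨hneg, by simpa using hδ⟩)
  exact ⟨r, hr.2, hr0⟩

/-- Discriminant of a cubic with a known root `r`. -/
theorem discr_of_root {α β γ δ r : ℝ} (hr : α * r ^ 3 + β * r ^ 2 + γ * r + δ = 0) :
    (⟨α, β, γ, δ⟩ : Cubic ℝ).discr =
      ((β + α * r) ^ 2 - 4 * α * (γ + (β + α * r) * r)) *
        (α * r ^ 2 + (β + α * r) * r + (γ + (β + α * r) * r)) ^ 2 := by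
  have hd : δ = -(α * r ^ 3 + β * r ^ 2 + γ * r) := by linarith
  simp only [Cubic.discr, hd]; ring

/-- When `δ > 0` there is a negative root, and a negative value at `t > 0` gives the quadratic
cofactor two distinct real roots, both positive. Three distinct real roots make the discriminant
positive. When `δ = 0` the hypothesis `β = γ` reduces it to an explicit product. -/
theorem discr_pos_of_neg_value {α β γ δ t : ℝ} (hα : 0 ≤ α) (hδ : 0 ≤ δ) (ht : 0 < t)
    (hαδ : α = 0 → δ = 0) (hβγ : δ = 0 → β = γ)
    (hneg : α * t ^ 3 + β * t ^ 2 + γ * t + δ < 0) :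
    0 < (⟨α, β, γ, δ⟩ : Cubic ℝ).discr := by
  rcases hδ.eq_or_lt with h0 | hδ'
  · have h := hβγ h0.symm
    subst h
    subst h0
    have h1 : β * (t * (t + 1)) < 0 := by nlinarith [pow_pos ht 3]
    have hβ : β < 0 := by
      by_contra! hβ
      have : 0 ≤ β * (t * (t + 1)) := by positivity
      linarith
    have h2 : 0 < (-β) ^ 3 * (4 * α - β) := by
      have : 0 < 4 * α - β := by linarith
      have : 0 < -β := by linarith
      positivity
    simp only [Cubic.discr]
    nlinarith
  · have hα' : 0 < α := lt_of_le_of_ne hα fun h => hδ'.ne' (hαδ h.symm)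
    obtain ⟨r, hr, hr0⟩ := exists_nonpos_root (β := β) (γ := γ) hα' hδ
    rw [discr_of_root hr0]
    have hr' : r < 0 := lt_of_le_of_ne hr fun h => by subst h; simp at hr0; linarith
    set p := β + α * r with hp
    set q := γ + p * r with hq
    have hqr : q * r = -δ := by rw [hq, hp]; linarith
    have hq0 : 0 < q := by
      by_contra! h
      have := mul_nonneg_of_nonpos_of_nonpos h hr
      linarith
    have hfac : α * t ^ 3 + β * t ^ 2 + γ * t + δ = (t - r) * (α * t ^ 2 + p * t + q) := by
      rw [hq, hp]; linear_combination hr0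
    have hquad : α * t ^ 2 + p * t + q < 0 := by
      by_contra! h
      have := mul_nonneg (by linarith : 0 ≤ t - r) h
      linarith
    have hp0 : p < 0 := by
      by_contra! h
      have : 0 ≤ α * t ^ 2 + p * t + q := by positivity
      linarith
    have h1 : 0 < p ^ 2 - 4 * α * q := by nlinarith [sq_nonneg (2 * α * t + p)]
    have h2 : 0 < α * r ^ 2 + p * r + q := by
      have := mul_pos_of_neg_of_neg hp0 hr'
      positivity
    positivity

/-- Split off a root `r ≤ 0`. If the cofactor had real roots, they would be negative, so `β` and `γ`
would be positive and real-rootedness would force `β ^ 2 ≥ 3 * α * γ`. The bounds `β ≤ γ` and `β < 3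
* α` forbid this. -/
theorem discr_neg_of_pos_values {α β γ δ : ℝ} (hα : 0 < α) (hδ : 0 ≤ δ) (hβγ : β ≤ γ)
    (hβα : β < 3 * α) (hγ : δ = 0 → 0 < γ)
    (hpos : ∀ t, 0 < t → 0 < α * t ^ 3 + β * t ^ 2 + γ * t + δ) :
    (⟨α, β, γ, δ⟩ : Cubic ℝ).discr < 0 := by
  obtain ⟨r, hr, hr0, hrδ⟩ : ∃ r ≤ 0, α * r ^ 3 + β * r ^ 2 + γ * r + δ = 0 ∧
      (δ = 0 → r = 0) := by
    rcases hδ.eq_or_lt with h | h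
    · exact ⟨0, le_rfl, by simp [← h], fun _ => rfl⟩
    · obtain ⟨r, h1, h2⟩ := exists_nonpos_root (β := β) (γ := γ) hα hδ
      exact ⟨r, h1, h2, fun h0 => absurd h0 h.ne'⟩
  rw [discr_of_root hr0]
  set p := β + α * r with hp
  set q := γ + p * r with hq
  have hqr : q * r = -δ := by rw [hq, hp]; linarith
  have hq0 : 0 < q := by
    rcases hδ.eq_or_lt with h | h
    · have := hγ h.symm
      rw [hq, hrδ h.symm]; linarith
    · by_contra! h'
      have := mul_nonneg_of_nonpos_of_nonpos h' hr
      linarith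
  have hfac : ∀ t, α * t ^ 3 + β * t ^ 2 + γ * t + δ = (t - r) * (α * t ^ 2 + p * t + q) := by
    intro t
    rw [hq, hp]; linear_combination hr0
  rcases lt_or_ge (p ^ 2 - 4 * α * q) 0 with h | h
  · have h1 : 0 < α * r ^ 2 + p * r + q := by nlinarith [sq_nonneg (2 * α * r + p)]
    exact mul_neg_of_neg_of_pos h (by positivity)
  · exfalso
    have hαq : 0 < α * q := mul_pos hα hq0
    have hp0 : 0 < p := by
      -- Otherwise the vertex of the quadratic is a positive point where its value is at most zero.
      by_contra! hp0
      have hp1 : p < 0 := lt_of_le_of_ne hp0 fun h0 => by rw [h0] at h; nlinarith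
      have ht : 0 < -p / (2 * α) := div_pos (by linarith) (by linarith)
      have h1 := hpos _ ht
      rw [hfac] at h1
      have h2 : 0 < α * (-p / (2 * α)) ^ 2 + p * (-p / (2 * α)) + q :=
        pos_of_mul_pos_right h1 (by linarith)
      have h3 : α * (-p / (2 * α)) ^ 2 + p * (-p / (2 * α)) + q = -(p ^ 2 - 4 * α * q) / (4 * α) := by
        field_simp; ring
      rw [h3, neg_div, neg_pos] at h2
      exact absurd (div_nonneg h (by linarith : 0 ≤ 4 * α)) (not_le.2 h2)
    have hβ0 : 0 < β := by nlinarith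
    have hγ0 : 0 < γ := by linarith
    -- The difference equals `(p / 2 + α * r) ^ 2` plus three quarters of the quadratic's
    -- discriminant.
    have h1 : 0 ≤ β ^ 2 - 3 * α * γ := by
      have h2 : β = p - α * r := by rw [hp]; ring
      have h3 : γ = q - p * r := by rw [hq]; ring
      rw [h2, h3]
      nlinarith [sq_nonneg (p / 2 + α * r)]
    nlinarith

/-- Adding `ε * (t ^ 2 + t)` makes the values strictly positive; then `ε` tends to 0. -/
theorem discr_nonpos_of_nonneg_values {α β γ δ : ℝ} (hα : 0 < α) (hδ : 0 ≤ δ) (hβγ : β ≤ γ)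
    (hβα : β < 3 * α) (hγ : δ = 0 → 0 ≤ γ)
    (hpos : ∀ t, 0 < t → 0 ≤ α * t ^ 3 + β * t ^ 2 + γ * t + δ) :
    (⟨α, β, γ, δ⟩ : Cubic ℝ).discr ≤ 0 := by
  have hc : Filter.Tendsto (fun ε : ℝ => (⟨α, β + ε, γ + ε, δ⟩ : Cubic ℝ).discr)
      (nhdsWithin 0 (Set.Ioi 0)) (nhds (⟨α, β, γ, δ⟩ : Cubic ℝ).discr) := by
    have : Continuous fun ε : ℝ => (⟨α, β + ε, γ + ε, δ⟩ : Cubic ℝ).discr := by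
      simp only [Cubic.discr]; fun_prop
    have h := (this.tendsto 0).mono_left (nhdsWithin_le_nhds (s := Set.Ioi 0))
    simpa using h
  refine le_of_tendsto hc ?_
  have hm : Set.Ioo (0 : ℝ) (3 * α - β) ∈ nhdsWithin (0 : ℝ) (Set.Ioi 0) :=
    Ioo_mem_nhdsGT (by linarith)
  filter_upwards [hm] with ε hε
  refine (discr_neg_of_pos_values hα hδ (by linarith) (by linarith [hε.2])
    (fun h => by linarith [hγ h, hε.1]) fun t ht => ?_).le
  have h1 := hpos t ht
  have h2 : 0 < ε * (t ^ 2 + t) := mul_pos hε.1 (by positivity)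
  nlinarith

/-! ### The pencil for ordered coordinates -/

theorem pencilCubic_b_le_c {a b c : ℝ} (hcb : c ≤ b) (hba : b ≤ a) :
    (pencilCubic a b c).b ≤ (pencilCubic a b c).c := by
  have : 0 ≤ (a - b) * ((a - c) * (b - c)) :=
    mul_nonneg (by linarith) (mul_nonneg (by linarith) (by linarith))
  simp only [pencilCubic]
  nlinarith

theorem pencilCubic_b_lt {a b c : ℝ} (hc : 0 < c) (hcb : c ≤ b) (hba : b ≤ a) (hca : c < a) :
    (pencilCubic a b c).b < 3 * (pencilCubic a b c).a := by
  simp only [pencilCubic]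
  have ha0 : 0 < a := hc.trans hca
  -- `e1` and `e2` are the values of the required inequality at the ends `b = c` and `b = a`.
  have e1 : 0 < (a + c) * (4 * c ^ 2) + 3 * ((a - c) * (a + c) ^ 2) - 8 * (a + 2 * c - 2) := by
    have h1 : 0 ≤ (a - 1) ^ 2 * (a + 2) := by positivity
    have h2 : 0 ≤ (c - 1) ^ 2 * (c + 2) := by positivity
    have h3 : 0 ≤ c * (a - 1) ^ 2 := by positivity
    have h4 : 0 ≤ (a - c) * c ^ 2 := mul_nonneg (by linarith) (by positivity)
    have h5 : 0 ≤ (a - c) * c := mul_nonneg (by linarith) hc.le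
    nlinarith [sq_nonneg (c - 1)]
  have e2 : 0 < (a + c) * (a ^ 2 + 3 * c ^ 2) + 3 * ((a - c) * (a + c) ^ 2) - 8 * (2 * a + c - 2) := by
    have h2 : 0 < a ^ 3 - 4 * a + 4 := by nlinarith [sq_nonneg (a - 6 / 5)]
    have h3 : 0 < a * ((a + c) * (a ^ 2 + 3 * c ^ 2) + 3 * ((a - c) * (a + c) ^ 2)
        - 8 * (2 * a + c - 2)) := by
      have h4 : 0 < (a - c) * (a ^ 3 - 4 * a + 4) := mul_pos (by linarith) h2
      have h5 : 0 ≤ c * ((a - 1) ^ 2 * (a + 2)) := by positivity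
      nlinarith
    exact pos_of_mul_pos_right h3 ha0.le
  -- the difference is affine in `b`
  have key : (a - c) * ((a + c) * (a * b - a * c + b * c + 3 * c ^ 2)
      + 3 * ((a - c) * (a + c) ^ 2) - 8 * (a + b + c - 2)) =
      (a - b) * ((a + c) * (4 * c ^ 2) + 3 * ((a - c) * (a + c) ^ 2) - 8 * (a + 2 * c - 2))
      + (b - c) * ((a + c) * (a ^ 2 + 3 * c ^ 2) + 3 * ((a - c) * (a + c) ^ 2)
        - 8 * (2 * a + c - 2)) := by ring
  have hpos : 0 < (a - c) * ((a + c) * (a * b - a * c + b * c + 3 * c ^ 2)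
      + 3 * ((a - c) * (a + c) ^ 2) - 8 * (a + b + c - 2)) := by
    rw [key]
    rcases hcb.eq_or_lt with h | h
    · have : 0 < a - b := by linarith
      have h2 : 0 ≤ b - c := by linarith
      positivity
    · have : 0 < b - c := by linarith
      have h2 : 0 ≤ a - b := by linarith
      positivity
  have := pos_of_mul_pos_right hpos (by linarith : 0 ≤ a - c)
  linarith

theorem discr_pencilCubic_pos {a b c t : ℝ} (hc : 0 < c) (hcb : c ≤ b) (hba : b ≤ a) (ht : 0 < t)
    (h : pencil a b c t < 0) : 0 < (pencilCubic a b c).discr := by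
  have hb0 : 0 < b := hc.trans_le hcb
  have ha0 : 0 < a := hb0.trans_le hba
  rw [pencil_eq] at h
  refine discr_pos_of_neg_value (α := (pencilCubic a b c).a) (β := (pencilCubic a b c).b)
    (γ := (pencilCubic a b c).c) (δ := (pencilCubic a b c).d) ?_ ?_ ht ?_ ?_ h
  · have : 0 ≤ a - c := by linarith
    simp only [pencilCubic]; positivity
  · have : 0 ≤ b - c := by linarith
    simp only [pencilCubic]; positivity
  · intro h0
    have h1 : (a - c) * (a + c) ^ 2 = 0 := h0
    have h2 : a - c = 0 := (mul_eq_zero.1 h1).resolve_right (by positivity)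
    have h3 : b - c = 0 := by linarith
    simp [pencilCubic, h3]
  · intro h0
    have h1 : (b - c) * (b + c) ^ 2 = 0 := h0
    have h2 : b - c = 0 := (mul_eq_zero.1 h1).resolve_right (by positivity)
    have h3 : b = c := by linarith
    simp only [pencilCubic, h3]; ring

theorem discr_pencilCubic_neg {a b c : ℝ} (hc : 0 < c) (hcb : c ≤ b) (hba : b ≤ a) (hca : c < a)
    (hbc : b = c → 0 < (pencilCubic a b c).c)
    (h : ∀ t, 0 < t → 0 < pencil a b c t) : (pencilCubic a b c).discr < 0 := by
  have hb0 : 0 < b := hc.trans_le hcb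
  have ha0 : 0 < a := hb0.trans_le hba
  refine discr_neg_of_pos_values (α := (pencilCubic a b c).a) (β := (pencilCubic a b c).b)
    (γ := (pencilCubic a b c).c) (δ := (pencilCubic a b c).d) ?_ ?_ (pencilCubic_b_le_c hcb hba)
    (pencilCubic_b_lt hc hcb hba hca) ?_ fun t ht => by rw [← pencil_eq]; exact h t ht
  · have : 0 < a - c := by linarith
    simp only [pencilCubic]; positivity
  · have : 0 ≤ b - c := by linarith
    simp only [pencilCubic]; positivity
  · intro h0
    have h1 : (b - c) * (b + c) ^ 2 = 0 := h0
    have h2 : b - c = 0 := (mul_eq_zero.1 h1).resolve_right (by positivity)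
    exact hbc (by linarith)

/-- For `b = c` the constant coefficient vanishes, so the cubic can be divided by `t` before letting
`t` tend to 0. -/
theorem nonneg_of_nonneg_values_of_eq {a c : ℝ}
    (h : ∀ t, 0 < t → 0 ≤ pencil a c c t) : 0 ≤ (pencilCubic a c c).c := by
  have hg : ∀ t, 0 < t → 0 ≤ (pencilCubic a c c).a * t ^ 2 + (pencilCubic a c c).b * t +
      (pencilCubic a c c).c := by
    intro t ht
    have h1 := h t ht
    rw [pencil_eq] at h1
    have hd : (pencilCubic a c c).d = 0 := by simp [pencilCubic]
    rw [hd] at h1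
    have h2 : 0 ≤ t * ((pencilCubic a c c).a * t ^ 2 + (pencilCubic a c c).b * t +
      (pencilCubic a c c).c) := by linarith
    exact nonneg_of_mul_nonneg_right h2 ht
  have hcont : Continuous fun t : ℝ => (pencilCubic a c c).a * t ^ 2 + (pencilCubic a c c).b * t +
      (pencilCubic a c c).c := by fun_prop
  have ht := (hcont.tendsto 0).mono_left (nhdsWithin_le_nhds (s := Set.Ioi 0))
  have := ge_of_tendsto ht (by filter_upwards [self_mem_nhdsWithin] with t ht using hg t ht)
  simpa using this

theorem discr_pencilCubic_nonpos {a b c : ℝ} (hc : 0 < c) (hcb : c ≤ b) (hba : b ≤ a)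
    (h : ∀ t, 0 < t → 0 ≤ pencil a b c t) : (pencilCubic a b c).discr ≤ 0 := by
  have hb0 : 0 < b := hc.trans_le hcb
  have ha0 : 0 < a := hb0.trans_le hba
  have hbc : b = c → 0 ≤ (pencilCubic a b c).c := by
    rintro rfl
    exact nonneg_of_nonneg_values_of_eq h
  rcases (hcb.trans hba).eq_or_lt with hca | hca
  -- The cubic degenerates when `a = b = c`; nonnegativity then forces the linear coefficient, a
  -- negative multiple of `(b - 1) ^ 2 * (b + 2)`, to vanish.
  · have hb : b = c := by linarith
    have h1 := hbc hb
    subst hca hb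
    have h2 : (pencilCubic b b b).c ≤ 0 := by
      have : 0 ≤ (b - 1) ^ 2 * (b + 2) := by positivity
      simp only [pencilCubic]; nlinarith
    have h3 : (pencilCubic b b b).c = 0 := le_antisymm h2 h1
    have h4 : (pencilCubic b b b).a = 0 := by simp [pencilCubic]
    have h5 : (pencilCubic b b b).d = 0 := by simp [pencilCubic]
    simp [Cubic.discr, h3, h4, h5]
  refine discr_nonpos_of_nonneg_values (α := (pencilCubic a b c).a) (β := (pencilCubic a b c).b)
    (γ := (pencilCubic a b c).c) (δ := (pencilCubic a b c).d) ?_ ?_ (pencilCubic_b_le_c hcb hba)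
    (pencilCubic_b_lt hc hcb hba hca) ?_ fun t ht => by rw [← pencil_eq]; exact h t ht
  · have : 0 < a - c := by linarith
    simp only [pencilCubic]; positivity
  · have : 0 ≤ b - c := by linarith
    simp only [pencilCubic]; positivity
  · intro h0
    have h1 : (b - c) * (b + c) ^ 2 = 0 := h0
    have h2 : b - c = 0 := (mul_eq_zero.1 h1).resolve_right (by positivity)
    exact hbc (by linarith)

theorem pencil_nonneg_of_discr_nonpos {a b c : ℝ} (hc : 0 < c) (hcb : c ≤ b) (hba : b ≤ a)
    (h : (pencilCubic a b c).discr ≤ 0) (t : ℝ) (ht : 0 < t) : 0 ≤ pencil a b c t := by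
  by_contra! h'
  exact absurd (discr_pencilCubic_pos hc hcb hba ht h') (not_lt.2 h)

/-- At `t = b / a` the last two factors are equal and positive, so the product must be beaten by a
positive first term. This supplies the positive threshold that the logarithms need on rays. -/
theorem two_lt_sum_of_pencil_nonneg {a b c : ℝ} (hc : 0 < c) (hcb : c ≤ b) (hba : b ≤ a)
    (h : ∀ t, 0 < t → 0 ≤ pencil a b c t) : 2 < a + b + c := by
  by_contra! hK
  have ha : 0 < a := by linarith
  have hb : 0 < b := by linarith
  have h1 := h (b / a) (by positivity)
  have h2 : 0 < b / a * (a + c) - (b - c) := by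
    have : b / a * (a + c) - (b - c) = c + b * c / a := by field_simp; ring
    rw [this]; positivity
  have h3 : 0 < (b + c) - b / a * (a - c) := by
    have : (b + c) - b / a * (a - c) = c + b * c / a := by field_simp; ring
    rw [this]; positivity
  have h4 : 0 < (b / a * (a + c) + (b + c)) * (b / a * (a + c) - (b - c)) *
      ((b + c) - b / a * (a - c)) := by positivity
  have h5 : 0 ≤ (2 - (a + b + c)) * (b / a * (b / a + 1)) :=
    mul_nonneg (by linarith) (by positivity)
  simp only [pencil] at h1
  linarith

/-! ### Log-concavity along rays orthogonal to the diagonal -/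

/-- A product of three positive affine functions stays above `k` on a segment
if it does so at the ends. -/
theorem lt_prod_convexCombo {x₁ x₂ x₃ y₁ y₂ y₃ k l : ℝ} (hx₁ : 0 < x₁) (hx₂ : 0 < x₂) (hx₃ : 0 < x₃)
    (hy₁ : 0 < y₁) (hy₂ : 0 < y₂) (hy₃ : 0 < y₃) (hk : 0 < k) (hx : k < x₁ * x₂ * x₃)
    (hy : k ≤ y₁ * y₂ * y₃) (hl : 0 ≤ l) (hl1 : l < 1) :
    k < ((1 - l) * x₁ + l * y₁) * ((1 - l) * x₂ + l * y₂) * ((1 - l) * x₃ + l * y₃) := by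
  have hl' : 0 < 1 - l := by linarith
  have cc : ∀ {x y : ℝ}, 0 < x → 0 < y →
      (1 - l) * Real.log x + l * Real.log y ≤ Real.log ((1 - l) * x + l * y) := by
    intro x y hx hy
    simpa using strictConcaveOn_log_Ioi.concaveOn.2 (Set.mem_Ioi.2 hx) (Set.mem_Ioi.2 hy) hl'.le hl
      (by ring)
  have pp : ∀ {x y : ℝ}, 0 < x → 0 < y → 0 < (1 - l) * x + l * y := by
    intro x y hx hy
    have := mul_pos hl' hx
    have := mul_nonneg hl hy.le
    linarith
  have p₁ := pp hx₁ hy₁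
  have p₂ := pp hx₂ hy₂
  have p₃ := pp hx₃ hy₃
  have lx := Real.log_lt_log hk hx
  have ly := Real.log_le_log hk hy
  rw [Real.log_mul (by positivity) (by positivity), Real.log_mul (by positivity) (by positivity)]
    at lx ly
  rw [← Real.log_lt_log_iff hk (by positivity), Real.log_mul (by positivity) (by positivity),
    Real.log_mul (by positivity) (by positivity)]
  have c₁ := cc hx₁ hy₁
  have c₂ := cc hx₂ hy₂
  have c₃ := cc hx₃ hy₃
  have := mul_lt_mul_of_pos_left lx hl'
  have := mul_le_mul_of_nonneg_left ly hl
  linarith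

theorem prod_lt_one_of_sum_lt_three {x y z : ℝ} (hx : 0 < x) (hy : 0 < y) (hz : 0 < z)
    (h : x + y + z < 3) : x * y * z < 1 := by
  have h1 : 27 * (x * y * z) ≤ (x + y + z) ^ 3 := by
    nlinarith [mul_nonneg hx.le (sq_nonneg (y - z)), mul_nonneg hy.le (sq_nonneg (x - z)),
      mul_nonneg hz.le (sq_nonneg (x - y)), mul_nonneg hx.le (sq_nonneg (x - y)),
      mul_nonneg hx.le (sq_nonneg (x - z)), mul_nonneg hy.le (sq_nonneg (x - y)),
      mul_nonneg hy.le (sq_nonneg (y - z)), mul_nonneg hz.le (sq_nonneg (x - z)),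
      mul_nonneg hz.le (sq_nonneg (y - z))]
  have h2 : (x + y + z) ^ 3 < 3 ^ 3 := by gcongr
  linarith

theorem pencil_factors_pos {a b c t : ℝ} (hc : 0 < c) (hcb : c ≤ b) (hba : b ≤ a) (ht : 0 < t)
    (h : 0 < (t * (a + c) + (b + c)) * (t * (a + c) - (b - c)) * ((b + c) - t * (a - c))) :
    0 < t * (a + c) + (b + c) ∧ 0 < t * (a + c) - (b - c) ∧ 0 < (b + c) - t * (a - c) := by
  have ha : 0 < a := by linarith
  have hb : 0 < b := by linarith
  have h1 : 0 < t * (a + c) + (b + c) := by positivity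
  rw [mul_assoc] at h
  have h2 := pos_of_mul_pos_right h h1.le
  -- The last two factors add up to this quantity, so they cannot both be negative.
  have h3 : 0 < 2 * c * (1 + t) := by positivity
  rcases mul_pos_iff.1 h2 with h4 | h4
  · exact ⟨h1, h4⟩
  · nlinarith [h4.1, h4.2]

section Ray

variable {m d₁ d₂ d₃ ρ ρ' : ℝ}

/-- Along the ray the first term of the pencil is a constant `k`. At the diagonal the product
exceeds `k` because `m ^ 3 - 3 * m + 2 = (m - 1) ^ 2 * (m + 2)`. Were it still at least `k` at `ρ'`,
log-concavity would put it strictly above `k` at `ρ`. For `m = 1` strictness at the diagonal is lost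
and AM-GM takes over. -/
theorem pencil_pos_of_lt (hd : d₁ + d₂ + d₃ = 0) (h32 : d₃ ≤ d₂) (h21 : d₂ ≤ d₁)
    (h31 : d₃ < d₁) (hρ : 0 ≤ ρ) (hρρ : ρ < ρ') (h0 : 0 < m + ρ' * d₃)
    (h : ∀ t, 0 < t → 0 ≤ pencil (m + ρ * d₁) (m + ρ * d₂) (m + ρ * d₃) t) (t : ℝ) (ht : 0 < t) :
    0 < pencil (m + ρ' * d₁) (m + ρ' * d₂) (m + ρ' * d₃) t := by
  have hρ' : 0 < ρ' := by linarith
  have hd3 : d₃ < 0 := by linarith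
  have hm : 0 < m := by nlinarith
  have o32 : m + ρ' * d₃ ≤ m + ρ' * d₂ := by gcongr
  have o21 : m + ρ' * d₂ ≤ m + ρ' * d₁ := by gcongr
  have p0 : 0 < m + ρ * d₃ := by nlinarith
  have p32 : m + ρ * d₃ ≤ m + ρ * d₂ := by gcongr
  have p21 : m + ρ * d₂ ≤ m + ρ * d₁ := by gcongr
  have hsum : ∀ s, (m + s * d₁) + (m + s * d₂) + (m + s * d₃) = 3 * m := by
    intro s; linear_combination s * hd
  have hK := two_lt_sum_of_pencil_nonneg p0 p32 p21 h
  rw [hsum] at hK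
  by_contra! hcon
  have hk : 0 < 8 * (3 * m - 2) * t * (t + 1) := by
    have : 0 < 3 * m - 2 := by linarith
    positivity
  have hL : 8 * (3 * m - 2) * t * (t + 1) ≤
      (t * ((m + ρ' * d₁) + (m + ρ' * d₃)) + ((m + ρ' * d₂) + (m + ρ' * d₃))) *
      (t * ((m + ρ' * d₁) + (m + ρ' * d₃)) - ((m + ρ' * d₂) - (m + ρ' * d₃))) *
      (((m + ρ' * d₂) + (m + ρ' * d₃)) - t * ((m + ρ' * d₁) - (m + ρ' * d₃))) := by
    simp only [pencil] at hcon
    rw [hsum] at hcon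
    linarith
  obtain ⟨l1, l2, l3⟩ := pencil_factors_pos h0 o32 o21 ht (hk.trans_le hL)
  rcases eq_or_ne m 1 with rfl | hm1
  · set y₁ := (t * ((1 + ρ' * d₁) + (1 + ρ' * d₃)) + ((1 + ρ' * d₂) + (1 + ρ' * d₃))) with hy₁
    set y₂ := (t * ((1 + ρ' * d₁) + (1 + ρ' * d₃)) - ((1 + ρ' * d₂) - (1 + ρ' * d₃))) with hy₂
    set y₃ := (((1 + ρ' * d₂) + (1 + ρ' * d₃)) - t * ((1 + ρ' * d₁) - (1 + ρ' * d₃))) with hy₃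
    -- Each factor is normalised by its value at the diagonal point.
    have h1 : y₁ / (2 * (t + 1)) + y₂ / (2 * t) + y₃ / 2 < 3 := by
      have e : 3 - (y₁ / (2 * (t + 1)) + y₂ / (2 * t) + y₃ / 2) =
          ρ' * (t ^ 2 + t + 1) * (t * (d₁ - d₂) + (d₂ - d₃) * (t + 1)) / (2 * t * (t + 1)) := by
        have hd1 : d₁ = - d₂ - d₃ := by linarith
        rw [hy₁, hy₂, hy₃, hd1]; field_simp; ring
      have h2 : 0 < t * (d₁ - d₂) + (d₂ - d₃) * (t + 1) := by
        have : 0 < t * (d₁ - d₃) := mul_pos ht (by linarith)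
        nlinarith
      have : 0 < ρ' * (t ^ 2 + t + 1) * (t * (d₁ - d₂) + (d₂ - d₃) * (t + 1)) /
        (2 * t * (t + 1)) := by positivity
      linarith
    have h2 := prod_lt_one_of_sum_lt_three (by positivity) (by positivity) (by positivity) h1
    have h3 : y₁ / (2 * (t + 1)) * (y₂ / (2 * t)) * (y₃ / 2) = y₁ * y₂ * y₃ / (8 * t * (t + 1)) := by
      field_simp; norm_num
    rw [h3, div_lt_one (by positivity)] at h2
    linarith
  · have hx : 8 * (3 * m - 2) * t * (t + 1) < (2 * m * (t + 1)) * (2 * m * t) * (2 * m) := by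
      have : 0 < (m - 1) ^ 2 * (m + 2) * (t * (t + 1)) := by
        have : m - 1 ≠ 0 := sub_ne_zero.2 hm1
        positivity
      nlinarith
    have key := lt_prod_convexCombo (l := ρ / ρ') (by positivity) (by positivity) (by positivity)
      l1 l2 l3 hk hx hL (by positivity) ((div_lt_one hρ').2 hρρ)
    have hN := h t ht
    simp only [pencil] at hN
    rw [hsum] at hN
    have hl : ρ / ρ' * ρ' = ρ := div_mul_cancel₀ _ hρ'.ne'
    generalize ρ / ρ' = l at hl key
    have e1 : (1 - l) * (2 * m * (t + 1)) +
        l * (t * ((m + ρ' * d₁) + (m + ρ' * d₃)) + ((m + ρ' * d₂) + (m + ρ' * d₃))) =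
        t * ((m + ρ * d₁) + (m + ρ * d₃)) + ((m + ρ * d₂) + (m + ρ * d₃)) := by
      linear_combination (t * (d₁ + d₃) + (d₂ + d₃)) * hl
    have e2 : (1 - l) * (2 * m * t) +
        l * (t * ((m + ρ' * d₁) + (m + ρ' * d₃)) - ((m + ρ' * d₂) - (m + ρ' * d₃))) =
        t * ((m + ρ * d₁) + (m + ρ * d₃)) - ((m + ρ * d₂) - (m + ρ * d₃)) := by
      linear_combination (t * (d₁ + d₃) - (d₂ - d₃)) * hl
    have e3 : (1 - l) * (2 * m) +
        l * (((m + ρ' * d₂) + (m + ρ' * d₃)) - t * ((m + ρ' * d₁) - (m + ρ' * d₃))) =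
        ((m + ρ * d₂) + (m + ρ * d₃)) - t * ((m + ρ * d₁) - (m + ρ * d₃)) := by
      linear_combination ((d₂ + d₃) - t * (d₁ - d₃)) * hl
    rw [e1, e2, e3] at key
    linarith

/-- Strict positivity for `t > 0` may degenerate as `t` tends to 0. For `b = c` the ray argument is
therefore repeated with the limiting factors `2 * c`, `2 * c` and `a + c`. -/
theorem pencilCubic_c_pos_of_lt (hd : d₁ + d₂ + d₃ = 0) (h32 : d₃ = d₂)
    (h31 : d₃ < d₁) (hρ : 0 ≤ ρ) (hρρ : ρ < ρ') (h0 : 0 < m + ρ' * d₃)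
    (h : ∀ t, 0 < t → 0 ≤ pencil (m + ρ * d₁) (m + ρ * d₂) (m + ρ * d₃) t) :
    0 < (pencilCubic (m + ρ' * d₁) (m + ρ' * d₂) (m + ρ' * d₃)).c := by
  subst h32
  have hρ' : 0 < ρ' := by linarith
  have hd3 : d₃ < 0 := by linarith
  have hm : 0 < m := by nlinarith
  have p0 : 0 < m + ρ * d₃ := by nlinarith
  have p21 : m + ρ * d₃ ≤ m + ρ * d₁ := by gcongr
  have hsum : ∀ s, (m + s * d₁) + (m + s * d₃) + (m + s * d₃) = 3 * m := by
    intro s; linear_combination s * hd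
  have hK := two_lt_sum_of_pencil_nonneg p0 le_rfl p21 h
  rw [hsum] at hK
  have hN := nonneg_of_nonneg_values_of_eq h
  by_contra! hcon
  simp only [pencilCubic] at hN hcon
  rw [hsum] at hN hcon
  have ha : 0 < m + ρ' * d₁ := by nlinarith
  have hL : 8 * (3 * m - 2) ≤ (2 * (m + ρ' * d₃)) * (2 * (m + ρ' * d₃)) *
      ((m + ρ' * d₁) + (m + ρ' * d₃)) := by linarith
  rcases eq_or_ne m 1 with rfl | hm1
  · have := prod_lt_one_of_sum_lt_three h0 h0
      (by positivity : 0 < ((1 + ρ' * d₁) + (1 + ρ' * d₃)) / 2) (by nlinarith)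
    linarith
  · have hx : 8 * (3 * m - 2) < (2 * m) * (2 * m) * (2 * m) := by
      have : 0 < (m - 1) ^ 2 * (m + 2) := by
        have : m - 1 ≠ 0 := sub_ne_zero.2 hm1
        positivity
      nlinarith
    have key := lt_prod_convexCombo (l := ρ / ρ') (by positivity) (by positivity) (by positivity)
      (by positivity) (by positivity) (by positivity) (by linarith) hx hL (by positivity)
      ((div_lt_one hρ').2 hρρ)
    have e1 : (1 - ρ / ρ') * (2 * m) + ρ / ρ' * (2 * (m + ρ' * d₃)) = 2 * (m + ρ * d₃) := by
      field_simp; ring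
    have e2 : (1 - ρ / ρ') * (2 * m) + ρ / ρ' * ((m + ρ' * d₁) + (m + ρ' * d₃)) =
        (m + ρ * d₁) + (m + ρ * d₃) := by field_simp; ring
    rw [e1, e2] at key
    linarith

theorem discr_neg_of_lt (hd : d₁ + d₂ + d₃ = 0) (h32 : d₃ ≤ d₂) (h21 : d₂ ≤ d₁)
    (h31 : d₃ < d₁) (hρ : 0 ≤ ρ) (hρρ : ρ < ρ') (h0 : 0 < m + ρ' * d₃)
    (h : (pencilCubic (m + ρ * d₁) (m + ρ * d₂) (m + ρ * d₃)).discr ≤ 0) :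
    (pencilCubic (m + ρ' * d₁) (m + ρ' * d₂) (m + ρ' * d₃)).discr < 0 := by
  have hρ' : 0 < ρ' := by linarith
  have o32 : m + ρ' * d₃ ≤ m + ρ' * d₂ := by gcongr
  have o21 : m + ρ' * d₂ ≤ m + ρ' * d₁ := by gcongr
  have o31 : m + ρ' * d₃ < m + ρ' * d₁ := by gcongr
  have p0 : 0 < m + ρ * d₃ := by nlinarith
  have p32 : m + ρ * d₃ ≤ m + ρ * d₂ := by gcongr
  have p21 : m + ρ * d₂ ≤ m + ρ * d₁ := by gcongr
  have hN := pencil_nonneg_of_discr_nonpos p0 p32 p21 h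
  refine discr_pencilCubic_neg h0 o32 o21 o31 (fun hbc => ?_)
    (pencil_pos_of_lt hd h32 h21 h31 hρ hρρ h0 hN)
  have : d₃ = d₂ := by
    have h1 : ρ' * (d₂ - d₃) = 0 := by linarith
    have := (mul_eq_zero.1 h1).resolve_left hρ'.ne'
    linarith
  exact pencilCubic_c_pos_of_lt hd this h31 hρ hρρ h0 hN

end Ray

/-! ### Contraction toward the singular point, (1, 1, 1) in scaled coordinates -/

section Star

variable {u v A B C e₁ e₂ e₃ h τ : ℝ}

/-- In the application `u = t / (t + 1)`, `v = 1 / (t + 1)`, `A = a - c`, `B = b - c`, `C = c - 1`,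
and the `eᵢ` are the relative deviations of the pencil factors from their values at (1, 1, 1). Since
`e₂ < 0`, only `e₁ * e₃` needs a bound. If `C ≤ 0`, then `e₃ ≤ 1` and `e₁ ≤ h`; if `C > 0`, both
factors are bounded through `u * v ≤ (1 - C) / 2`. -/
theorem pairSum_le_of_neg (hu : 0 < u) (hv : 0 < v) (huv : u + v = 1) (hA : 0 ≤ A) (hB : 0 ≤ B)
    (hAC : A + C ≤ 1) (hBC : B + C ≤ 1) (he₁ : e₁ = C + (u * A + v * B) / 2)
    (he₂ : 2 * u * e₂ = 2 * u * C + (u * A - v * B))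
    (he₃ : 2 * v * e₃ = 2 * v * C - (u * A - v * B))
    (hh : 2 * (u * v) * h = (1 - u * v) * (u * A + v * B))
    (h₁ : 0 < e₁) (h₂ : e₂ < 0) (h₃ : 0 < e₃) :
    e₁ * e₂ + e₁ * e₃ + e₂ * e₃ ≤ h := by
  have huA : 0 ≤ u * A := by positivity
  have hvB : 0 ≤ v * B := by positivity
  have hp : 0 < u * v := by positivity
  have hp4 : u * v ≤ 1 / 4 := by nlinarith [sq_nonneg (u - v)]
  have hE : e₁ * e₂ + e₁ * e₃ + e₂ * e₃ ≤ e₁ * e₃ := by nlinarith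
  refine hE.trans ?_
  have hAu : u * A ≤ u * (1 - C) := by gcongr; linarith
  have hBv : v * B ≤ v * (1 - C) := by gcongr; linarith
  have hw : u * A + v * B ≤ 1 - C := by
    have : u * (1 - C) + v * (1 - C) = 1 - C := by rw [← add_mul, huv, one_mul]
    linarith
  rcases le_or_gt C 0 with hC | hC
  · have h3 : e₃ ≤ 1 := by
      have hvC : v * C ≤ 0 := mul_nonpos_of_nonneg_of_nonpos hv.le hC
      have : v * e₃ ≤ v * 1 := by linarith
      exact le_of_mul_le_mul_left this hv
    have h4 : u * v * e₁ ≤ u * v * h := by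
      have k1 : u * v * C ≤ 0 := mul_nonpos_of_nonneg_of_nonpos hp.le hC
      have k2 : 0 ≤ (1 - 2 * (u * v)) * (u * A + v * B) := mul_nonneg (by linarith) (by linarith)
      rw [he₁]
      linarith
    exact (mul_le_of_le_one_right h₁.le h3).trans (le_of_mul_le_mul_left h4 hp)
  · have h5 : v * e₃ = C - u * e₂ := by linarith [congrArg (· * C) huv]
    have h6 : u * (1 + C) ≤ 1 - C := by
      have k1 : u * e₂ ≤ 0 := mul_nonpos_of_nonneg_of_nonpos hu.le h₂.le
      have k2 : v = 1 - u := by linarith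
      rw [k2] at hBv he₂
      linarith
    have h7 : u * v ≤ (1 - C) / 2 := by
      rcases le_or_gt v ((1 + C) / 2) with h | h
      · have := mul_le_mul_of_nonneg_left h hu.le
        linarith
      · have := mul_le_of_le_one_right hu.le (by linarith : v ≤ 1)
        linarith
    have h8 : e₁ ≤ 1 - u * v := by linarith
    have h9 : v * e₃ ≤ C - e₂ := by
      have := mul_nonpos_of_nonneg_of_nonpos (by linarith : 0 ≤ 1 - u) h₂.le
      linarith
    have h10 : e₁ * (v * e₃) ≤ (1 - u * v) * (C - e₂) :=
      mul_le_mul h8 h9 (by positivity) (by linarith)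
    have h11 : u * (C - e₂) ≤ (u * A + v * B) / 2 := by linarith
    have h12 : u * v * (e₁ * e₃) ≤ u * v * h := by
      have h13 : u * (e₁ * (v * e₃)) ≤ u * ((1 - u * v) * (C - e₂)) := by gcongr
      have h14 : (1 - u * v) * (u * (C - e₂)) ≤ (1 - u * v) * ((u * A + v * B) / 2) :=
        mul_le_mul_of_nonneg_left h11 (by linarith)
      linarith
    exact le_of_mul_le_mul_left h12 hp

/-- The value `h` at `τ = 0` is nonnegative. If `e₁ * e₂ * e₃ ≥ 0` the quadratic is concave and its
ends suffice. Otherwise either one deviation is negative and the pair sum is at most `h`, or all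
three are negative and the quadratic decreases on [0, 1]. -/
theorem quadratic_nonneg_of_endpoint (hu : 0 < u) (hv : 0 < v) (huv : u + v = 1) (hA : 0 ≤ A)
    (hB : 0 ≤ B) (hC : -1 < C) (hAC : A + C ≤ 1) (hBC : B + C ≤ 1)
    (he₁ : e₁ = C + (u * A + v * B) / 2)
    (he₂ : 2 * u * e₂ = 2 * u * C + (u * A - v * B))
    (he₃ : 2 * v * e₃ = 2 * v * C - (u * A - v * B))
    (hh : 2 * (u * v) * h = (1 - u * v) * (u * A + v * B))
    (hτ : 0 ≤ τ) (hτ1 : τ ≤ 1)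
    (h1 : 0 ≤ h - (e₁ * e₂ + e₁ * e₃ + e₂ * e₃) - e₁ * e₂ * e₃) :
    0 ≤ h - τ * (e₁ * e₂ + e₁ * e₃ + e₂ * e₃) - τ ^ 2 * (e₁ * e₂ * e₃) := by
  have huA : 0 ≤ u * A := by positivity
  have hvB : 0 ≤ v * B := by positivity
  have hp : 0 < u * v := by positivity
  have hp4 : u * v ≤ 1 / 4 := by nlinarith [sq_nonneg (u - v)]
  have hh0 : 0 ≤ h := by
    have : 0 ≤ 2 * (u * v) * h := by
      rw [hh]; exact mul_nonneg (by linarith) (by linarith)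
    exact nonneg_of_mul_nonneg_right this (by positivity)
  have hsum : u * e₂ + v * e₃ = C := by linarith [congrArg (· * C) huv]
  have hτ' : 0 ≤ τ * (1 - τ) := mul_nonneg hτ (by linarith)
  rcases le_or_gt 0 (e₁ * e₂ * e₃) with h3 | h3
  · have := mul_nonneg hτ' h3
    have := mul_nonneg (by linarith : 0 ≤ 1 - τ) hh0
    have := mul_nonneg hτ h1
    nlinarith
  have final : e₁ * e₂ + e₁ * e₃ + e₂ * e₃ ≤ h →
      0 ≤ h - τ * (e₁ * e₂ + e₁ * e₃ + e₂ * e₃) - τ ^ 2 * (e₁ * e₂ * e₃) := by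
    intro hle
    have := mul_nonneg hτ (sub_nonneg.2 hle)
    have := mul_nonneg (by linarith : 0 ≤ 1 - τ) hh0
    have : τ ^ 2 * (e₁ * e₂ * e₃) ≤ 0 := mul_nonpos_of_nonneg_of_nonpos (by positivity) h3.le
    linarith
  rcases lt_or_ge 0 e₁ with p1 | p1
  · rw [mul_assoc] at h3
    have h4 : e₂ * e₃ < 0 := by
      by_contra! h'
      have := mul_nonneg p1.le h'
      linarith
    rcases mul_neg_iff.1 h4 with ⟨p2, p3⟩ | ⟨p2, p3⟩
    · apply final
      have := pairSum_le_of_neg (u := v) (v := u) (A := B) (B := A) (C := C) (e₁ := e₁) (e₂ := e₃)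
        (e₃ := e₂) (h := h) hv hu (by linarith) hB hA hBC hAC (by linarith) (by linarith)
        (by linarith) (by linarith) p1 p3 p2
      linarith
    · exact final (pairSum_le_of_neg hu hv huv hA hB hAC hBC he₁ he₂ he₃ hh p1 p2 p3)
  · have p1' : e₁ < 0 := lt_of_le_of_ne p1 fun h0 => by simp [h0] at h3
    have h4 : 0 < e₂ * e₃ := by
      by_contra! h'
      have := mul_nonneg_of_nonpos_of_nonpos p1 h'
      linarith
    rcases mul_pos_iff.1 h4 with ⟨p2, p3⟩ | ⟨p2, p3⟩
    · have := mul_pos hu p2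
      have := mul_pos hv p3
      linarith
    · have q1 : -1 ≤ e₁ := by linarith
      -- At most one of `e₂`, `e₃` lies below -1, since their weighted mean is `C > -1`.
      have key : 0 ≤ e₁ * e₂ + e₁ * e₃ + e₂ * e₃ + 2 * (e₁ * e₂ * e₃) := by
        have k1 : 0 ≤ e₂ * e₃ * (1 + e₁) := mul_nonneg h4.le (by linarith)
        rcases le_or_gt (-1) e₂ with q2 | q2
        · have k2 : 0 ≤ e₁ * e₃ * (1 + e₂) :=
            mul_nonneg (mul_nonneg_of_nonpos_of_nonpos p1 p3.le) (by linarith)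
          have k3 := mul_nonneg_of_nonpos_of_nonpos p1 p2.le
          linarith
        · have q3 : -1 ≤ e₃ := by
            by_contra! q3
            nlinarith
          have k2 : 0 ≤ e₁ * e₂ * (1 + e₃) :=
            mul_nonneg (mul_nonneg_of_nonpos_of_nonpos p1 p2.le) (by linarith)
          have k3 := mul_nonneg_of_nonpos_of_nonpos p1 p3.le
          linarith
      have k4 : 0 ≤ e₁ * e₂ + e₁ * e₃ + e₂ * e₃ + (1 + τ) * (e₁ * e₂ * e₃) := by nlinarith
      have := mul_nonneg (by linarith : 0 ≤ 1 - τ) k4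
      linarith

end Star

/-- The pencil vanishes identically at (1, 1, 1), so along the segment it is the parameter times a
quadratic. -/
theorem pencil_nonneg_toward_one {a b c t τ : ℝ} (hc : 0 < c) (hcb : c ≤ b) (hca : c ≤ a)
    (ha : a ≤ 2) (hb : b ≤ 2) (ht : 0 < t) (hτ : 0 ≤ τ) (hτ1 : τ ≤ 1) (h : 0 ≤ pencil a b c t) :
    0 ≤ pencil (1 + τ * (a - 1)) (1 + τ * (b - 1)) (1 + τ * (c - 1)) t := by
  set e₁ := (t * (a + c) + (b + c)) / (2 * (t + 1)) - 1 with he₁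
  set e₂ := (t * (a + c) - (b - c)) / (2 * t) - 1 with he₂
  set e₃ := ((b + c) - t * (a - c)) / 2 - 1 with he₃
  set h0 := a + b + c - 3 - (e₁ + e₂ + e₃) with hh0
  have hexp : ∀ s : ℝ, pencil (1 + s * (a - 1)) (1 + s * (b - 1)) (1 + s * (c - 1)) t =
      8 * t * (t + 1) * s *
        (h0 - s * (e₁ * e₂ + e₁ * e₃ + e₂ * e₃) - s ^ 2 * (e₁ * e₂ * e₃)) := by
    intro s
    have l1 : t * (a + c) + (b + c) = 2 * (t + 1) * (1 + e₁) := by rw [he₁]; field_simp; ring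
    have l2 : t * (a + c) - (b - c) = 2 * t * (1 + e₂) := by rw [he₂]; field_simp; ring
    have l3 : (b + c) - t * (a - c) = 2 * (1 + e₃) := by rw [he₃]; ring
    have m1 : t * ((1 + s * (a - 1)) + (1 + s * (c - 1))) + ((1 + s * (b - 1)) + (1 + s * (c - 1)))
        = 2 * (t + 1) * (1 + s * e₁) := by linear_combination s * l1
    have m2 : t * ((1 + s * (a - 1)) + (1 + s * (c - 1))) - ((1 + s * (b - 1)) - (1 + s * (c - 1)))
        = 2 * t * (1 + s * e₂) := by linear_combination s * l2
    have m3 : ((1 + s * (b - 1)) + (1 + s * (c - 1))) - t * ((1 + s * (a - 1)) - (1 + s * (c - 1)))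
        = 2 * (1 + s * e₃) := by linear_combination s * l3
    simp only [pencil, m1, m2, m3]
    rw [hh0]; ring
  rw [hexp]
  have h1 := hexp 1
  simp only [one_mul, add_sub_cancel, one_pow, mul_one] at h1
  rw [h1] at h
  have h2 := nonneg_of_mul_nonneg_right h (by positivity : 0 < 8 * t * (t + 1))
  have ht1 : (0 : ℝ) < t + 1 := by positivity
  refine mul_nonneg (by positivity) (quadratic_nonneg_of_endpoint (u := t / (t + 1))
    (v := 1 / (t + 1)) (A := a - c) (B := b - c) (C := c - 1) (by positivity) (by positivity)
    (by field_simp) (by linarith) (by linarith) (by linarith) (by linarith) (by linarith)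
    ?_ ?_ ?_ ?_ hτ hτ1 h2)
  · rw [he₁]; field_simp; ring
  · rw [he₂]; field_simp; ring
  · rw [he₃]; field_simp; ring
  · rw [hh0, he₁, he₂, he₃]; field_simp; ring

theorem discr_nonpos_toward_one {a b c τ : ℝ} (hc : 0 < c) (hcb : c ≤ b) (hba : b ≤ a)
    (ha : a ≤ 2) (hτ : 0 ≤ τ) (hτ1 : τ ≤ 1) (h : (pencilCubic a b c).discr ≤ 0) :
    (pencilCubic (1 + τ * (a - 1)) (1 + τ * (b - 1)) (1 + τ * (c - 1))).discr ≤ 0 := by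
  refine discr_pencilCubic_nonpos ?_ (by gcongr) (by gcongr) fun t ht =>
    pencil_nonneg_toward_one hc hcb (hcb.trans hba) ha (hba.trans ha) ht hτ hτ1
      (pencil_nonneg_of_discr_nonpos hc hcb hba h t ht)
  nlinarith

/-! ### Transfer to `ricciQ` by symmetry -/

/-- Moving away from the diagonal within a plane orthogonal to it, `ricciQ` stays positive
once it is nonnegative. -/
theorem ricciQ_pos_of_lt {m d₁ d₂ d₃ ρ ρ' : ℝ} (hd : d₁ + d₂ + d₃ = 0)
    (hne : ¬(d₁ = 0 ∧ d₂ = 0 ∧ d₃ = 0)) (hρ : 0 ≤ ρ) (hρρ : ρ < ρ') (h1 : 0 < m + ρ' * d₁)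
    (h2 : 0 < m + ρ' * d₂) (h3 : 0 < m + ρ' * d₃)
    (h : 0 ≤ ricciQ (m + ρ * d₁) (m + ρ * d₂) (m + ρ * d₃)) :
    0 < ricciQ (m + ρ' * d₁) (m + ρ' * d₂) (m + ρ' * d₃) := by
  have sorted : ∀ x y z : ℝ, x + y + z = 0 → z ≤ y → y ≤ x → ¬(x = 0 ∧ y = 0 ∧ z = 0) →
      0 < m + ρ' * z → 0 ≤ ricciQ (m + ρ * x) (m + ρ * y) (m + ρ * z) →
      0 < ricciQ (m + ρ' * x) (m + ρ' * y) (m + ρ' * z) := by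
    intro x y z hs hzy hyx hn hz hQ
    rw [ricciQ_eq_discr] at hQ ⊢
    have e : ∀ s w : ℝ, 4 * (m + s * w) = 4 * m + s * (4 * w) := fun s w => by ring
    simp only [e] at hQ ⊢
    have hzx : z < x := by
      refine lt_of_le_of_ne (hzy.trans hyx) fun h0 => hn ?_
      refine ⟨?_, ?_, ?_⟩ <;> linarith
    have := discr_neg_of_lt (m := 4 * m) (d₁ := 4 * x) (d₂ := 4 * y) (d₃ := 4 * z) (ρ := ρ)
      (ρ' := ρ') (by linarith) (by linarith) (by linarith) (by linarith) hρ hρρ (by linarith)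
      (by linarith)
    linarith
  have s12 : ∀ x y z, ricciQ x y z = ricciQ y x z := fun x y z => by
    simp only [ricciQ, ricciQSymm]; ring
  have s23 : ∀ x y z, ricciQ x y z = ricciQ x z y := fun x y z => by
    simp only [ricciQ, ricciQSymm]; ring
  rcases le_total d₁ d₂ with h12 | h12 <;> rcases le_total d₂ d₃ with h23 | h23 <;>
    rcases le_total d₁ d₃ with h13 | h13
  · rw [s12, s23, s12] at h ⊢; exact sorted d₃ d₂ d₁ (by linarith) h12 h23 (by tauto) h1 h
  · rw [s12, s23, s12] at h ⊢; exact sorted d₃ d₂ d₁ (by linarith) h12 h23 (by tauto) h1 h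
  · rw [s12, s23] at h ⊢; exact sorted d₂ d₃ d₁ (by linarith) h13 h23 (by tauto) h1 h
  · rw [s12] at h ⊢; exact sorted d₂ d₁ d₃ (by linarith) h13 h12 (by tauto) h3 h
  · rw [s23, s12] at h ⊢; exact sorted d₃ d₁ d₂ (by linarith) h12 h13 (by tauto) h2 h
  · rw [s23] at h ⊢; exact sorted d₁ d₃ d₂ (by linarith) h23 h13 (by tauto) h2 h
  · exact sorted d₁ d₂ d₃ hd h23 h12 (by tauto) h3 h
  · exact sorted d₁ d₂ d₃ hd h23 h12 (by tauto) h3 h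

/-- Nonnegativity of `ricciQ` propagates along segments towards `(1/4, 1/4, 1/4)`. -/
theorem ricciQ_nonneg_toward_quarter {a b c τ : ℝ} (ha : a ∈ Set.Ioc (0 : ℝ) (1 / 2))
    (hb : b ∈ Set.Ioc (0 : ℝ) (1 / 2)) (hc : c ∈ Set.Ioc (0 : ℝ) (1 / 2)) (hτ : 0 ≤ τ)
    (hτ1 : τ ≤ 1) (h : 0 ≤ ricciQ a b c) :
    0 ≤ ricciQ (1 / 4 + τ * (a - 1 / 4)) (1 / 4 + τ * (b - 1 / 4)) (1 / 4 + τ * (c - 1 / 4)) := by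
  have sorted : ∀ x y z : ℝ, z ≤ y → y ≤ x → 0 < z → x ≤ 1 / 2 → 0 ≤ ricciQ x y z →
      0 ≤ ricciQ (1 / 4 + τ * (x - 1 / 4)) (1 / 4 + τ * (y - 1 / 4)) (1 / 4 + τ * (z - 1 / 4)) := by
    intro x y z hzy hyx hz hx hQ
    rw [ricciQ_eq_discr] at hQ ⊢
    have e : ∀ w : ℝ, 4 * (1 / 4 + τ * (w - 1 / 4)) = 1 + τ * (4 * w - 1) := fun w => by ring
    simp only [e]
    have := discr_nonpos_toward_one (a := 4 * x) (b := 4 * y) (c := 4 * z) (τ := τ)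
      (by linarith) (by linarith) (by linarith) (by linarith) hτ hτ1 (by linarith)
    linarith
  have s12 : ∀ x y z, ricciQ x y z = ricciQ y x z := fun x y z => by
    simp only [ricciQ, ricciQSymm]; ring
  have s23 : ∀ x y z, ricciQ x y z = ricciQ x z y := fun x y z => by
    simp only [ricciQ, ricciQSymm]; ring
  rcases le_total a b with h12 | h12 <;> rcases le_total b c with h23 | h23 <;>
    rcases le_total a c with h13 | h13
  · rw [s12, s23, s12] at h ⊢; exact sorted c b a h12 h23 ha.1 hc.2 h
  · rw [s12, s23, s12] at h ⊢; exact sorted c b a h12 h23 ha.1 hc.2 h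
  · rw [s12, s23] at h ⊢; exact sorted b c a h13 h23 ha.1 hb.2 h
  · rw [s12] at h ⊢; exact sorted b a c h13 h12 hc.1 hb.2 h
  · rw [s23, s12] at h ⊢; exact sorted c a b h12 h13 hb.1 hc.2 h
  · rw [s23] at h ⊢; exact sorted a c b h23 h13 hb.1 ha.2 h
  · exact sorted a b c h23 h12 hc.1 ha.2 h
  · exact sorted a b c h23 h12 hc.1 ha.2 h

theorem ricciQ_diag (m : ℝ) : ricciQ m m m = -((4 * m - 1) ^ 8 * (2 * m + 1) ^ 4) := by
  simp only [ricciQ, ricciQSymm]; ring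

/-! ### Components, and coordinates around the diagonal -/

/-- A space partitioned into `n` nonempty connected open sets has `n` connected components. -/
theorem natCard_connectedComponents_of_partition {X : Type*} [TopologicalSpace X] {n : ℕ}
    (U : Fin n → Set X) (hopen : ∀ i, IsOpen (U i)) (hcover : ∀ x, ∃ i, x ∈ U i)
    (hdisj : ∀ i j x, x ∈ U i → x ∈ U j → i = j) (hconn : ∀ i, IsConnected (U i)) :
    Nat.card (ConnectedComponents X) = n := by
  choose f hf using hcover
  have hfib : ∀ x i, f x = i ↔ x ∈ U i := fun x i =>
    ⟨fun h => h ▸ hf x, fun h => hdisj _ _ x (hf x) h⟩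
  have hcont : Continuous f := by
    refine IsLocallyConstant.continuous (IsLocallyConstant.iff_isOpen_fiber.2 fun i => ?_)
    have : f ⁻¹' {i} = U i := by ext x; exact hfib x i
    rw [this]
    exact hopen i
  have hbij : Function.Bijective hcont.connectedComponentsLift := by
    constructor
    · intro a b hab
      obtain ⟨x, rfl⟩ := ConnectedComponents.surjective_coe a
      obtain ⟨y, rfl⟩ := ConnectedComponents.surjective_coe b
      simp only [Continuous.connectedComponentsLift_apply_coe] at hab
      rw [ConnectedComponents.coe_eq_coe']
      exact (hconn (f y)).isPreconnected.subset_connectedComponent (hf y) ((hfib x _).1 hab)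
    · intro i
      obtain ⟨x, hx⟩ := (hconn i).nonempty
      exact ⟨x, by rw [Continuous.connectedComponentsLift_apply_coe]; exact (hfib x i).2 hx⟩
  rw [Nat.card_eq_of_bijective _ hbij, Nat.card_fin]

/-- The polynomial `ricciQ` as a function on `ℝ³`. -/
def ricciFun (x : Fin 3 → ℝ) : ℝ := ricciQ (x 0) (x 1) (x 2)

theorem continuous_ricciFun : Continuous ricciFun := by
  unfold ricciFun ricciQ ricciQSymm; fun_prop

/-- The point at position `m` on the diagonal, displaced by `ρ` times `d`. -/
def axisPoint (m ρ : ℝ) (d : Fin 3 → ℝ) : Fin 3 → ℝ := fun i => m + ρ * d i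

/-- The mean of the coordinates. -/
noncomputable def mean (x : Fin 3 → ℝ) : ℝ := (x 0 + x 1 + x 2) / 3

/-- The deviation of a point from its projection to the diagonal. -/
noncomputable def dev (x : Fin 3 → ℝ) : Fin 3 → ℝ := fun i => x i - mean x

theorem continuous_mean : Continuous mean := by unfold mean; fun_prop

theorem axisPoint_mean_dev (x : Fin 3 → ℝ) : axisPoint (mean x) 1 (dev x) = x := by
  ext i; simp [axisPoint, dev]

theorem dev_sum (x : Fin 3 → ℝ) : dev x 0 + dev x 1 + dev x 2 = 0 := by
  simp only [dev, mean]; ring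

theorem mean_axisPoint {m ρ : ℝ} {d : Fin 3 → ℝ} (hd : d 0 + d 1 + d 2 = 0) :
    mean (axisPoint m ρ d) = m := by
  simp only [mean, axisPoint]; linear_combination ρ / 3 * hd

theorem axisPoint_zero (m ρ : ℝ) : axisPoint m ρ 0 = fun _ => m := by
  ext i; simp [axisPoint]

theorem axisPoint_zero_left (m : ℝ) (d : Fin 3 → ℝ) : axisPoint m 0 d = fun _ => m := by
  ext i; simp [axisPoint]

theorem mean_mem {x : Fin 3 → ℝ} (hx : x ∈ halfOpenCube) : mean x ∈ Set.Ioc (0 : ℝ) (1 / 2) := by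
  have h0 := hx 0
  have h1 := hx 1
  have h2 := hx 2
  simp only [mean, Set.mem_Ioc] at *
  constructor <;> linarith [h0.1, h0.2, h1.1, h1.2, h2.1, h2.2]

theorem convex_halfOpenCube : Convex ℝ halfOpenCube := by
  intro x hx y hy a b ha hb hab i
  exact convex_Ioc 0 (1 / 2) (hx i) (hy i) ha hb hab

theorem const_mem_halfOpenCube {m : ℝ} (hm : m ∈ Set.Ioc (0 : ℝ) (1 / 2)) :
    (fun _ => m) ∈ halfOpenCube := fun _ => hm

theorem axisPoint_mem_halfOpenCube {x : Fin 3 → ℝ} (hx : x ∈ halfOpenCube) {τ ρ : ℝ} (hρ : 0 ≤ ρ)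
    (hρτ : ρ ≤ τ) (hτ : τ ≤ 1) :
    axisPoint (1 / 4 + τ * (mean x - 1 / 4)) ρ (dev x) ∈ halfOpenCube := by
  intro i
  have hm := mean_mem hx
  have h1 : axisPoint (1 / 4 + τ * (mean x - 1 / 4)) ρ (dev x) i =
      (1 - τ) * (1 / 4) + (τ - ρ) * mean x + ρ * x i := by simp only [axisPoint, dev]; ring
  have hxi := hx i
  rw [h1]
  have a1 := mul_nonneg (sub_nonneg.2 hρτ) hm.1.le
  have a2 := mul_nonneg hρ hxi.1.le
  have a3 := mul_le_mul_of_nonneg_left hm.2 (sub_nonneg.2 hρτ)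
  have a4 := mul_le_mul_of_nonneg_left hxi.2 hρ
  refine ⟨?_, by linarith⟩
  rcases hτ.lt_or_eq with h | h
  · linarith
  · rcases hρτ.lt_or_eq with h' | h'
    · have := mul_pos (sub_pos.2 h') hm.1
      linarith
    · have : 0 < ρ * x i := mul_pos (by linarith) hxi.1
      linarith

theorem ricciFun_pos_of_lt {m ρ ρ' : ℝ} {d : Fin 3 → ℝ} (hd : d 0 + d 1 + d 2 = 0) (hne : d ≠ 0)
    (hρ : 0 ≤ ρ) (hρρ : ρ < ρ') (hmem : axisPoint m ρ' d ∈ halfOpenCube)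
    (h : 0 ≤ ricciFun (axisPoint m ρ d)) : 0 < ricciFun (axisPoint m ρ' d) := by
  refine ricciQ_pos_of_lt hd ?_ hρ hρρ (hmem 0).1 (hmem 1).1 (hmem 2).1 h
  rintro ⟨h0, h1, h2⟩
  apply hne
  ext i
  fin_cases i <;> assumption

theorem ricciFun_nonneg_toward_quarter {x : Fin 3 → ℝ} (hx : x ∈ halfOpenCube) {τ : ℝ}
    (hτ : 0 ≤ τ) (hτ1 : τ ≤ 1) (h : 0 ≤ ricciFun x) :
    0 ≤ ricciFun (axisPoint (1 / 4 + τ * (mean x - 1 / 4)) τ (dev x)) := by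
  have h1 := ricciQ_nonneg_toward_quarter (hx 0) (hx 1) (hx 2) hτ hτ1 h
  have h2 : ∀ i, axisPoint (1 / 4 + τ * (mean x - 1 / 4)) τ (dev x) i
      = 1 / 4 + τ * (x i - 1 / 4) := by intro i; simp only [axisPoint, dev]; ring
  simpa only [ricciFun, h2] using h1

theorem ricciFun_const_nonpos (m : ℝ) : ricciFun (fun _ => m) ≤ 0 := by
  rw [ricciFun, ricciQ_diag]
  have : 0 ≤ (4 * m - 1) ^ 8 * (2 * m + 1) ^ 4 := by positivity
  linarith

theorem ricciFun_const_neg {m : ℝ} (hm : 0 < m) (h : m ≠ 1 / 4) : ricciFun (fun _ => m) < 0 := by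
  rw [ricciFun, ricciQ_diag]
  have h1 : 4 * m - 1 ≠ 0 := fun h' => h (by linarith)
  have : 0 < (4 * m - 1) ^ 8 * (2 * m + 1) ^ 4 := by positivity
  linarith

theorem ricciFun_quarter : ricciFun (fun _ => 1 / 4) = 0 := by
  rw [ricciFun, ricciQ_diag]; norm_num

theorem eq_const_of_dev_eq_zero {x : Fin 3 → ℝ} (h : dev x = 0) : x = fun _ => mean x := by
  conv_lhs => rw [← axisPoint_mean_dev x, h, axisPoint_zero]

theorem continuous_axisPoint (d : Fin 3 → ℝ) : Continuous fun p : ℝ × ℝ => axisPoint p.1 p.2 d := by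
  unfold axisPoint; fun_prop

theorem nonneg_of_mean_eq_quarter {x : Fin 3 → ℝ} (hx : x ∈ halfOpenCube) (hm : mean x = 1 / 4) :
    0 ≤ ricciFun x := by
  by_cases hd : dev x = 0
  · rw [eq_const_of_dev_eq_zero hd, hm, ricciFun_quarter]
  · have h := ricciFun_pos_of_lt (m := mean x) (ρ := 0) (ρ' := 1) (dev_sum x) hd le_rfl one_pos
      (by rwa [axisPoint_mean_dev]) (by rw [axisPoint_zero_left, hm, ricciFun_quarter])
    rw [axisPoint_mean_dev] at h
    exact h.le

/-! ### Connectedness of the three sign regions -/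

/-- Each point slides to the diagonal at constant mean; a nonnegative value on the way would make
the starting point positive. -/
theorem isConnected_neg_region {J : Set ℝ} (hJ : IsPreconnected J) (hne : J.Nonempty)
    (hJs : J ⊆ Set.Ioc 0 (1 / 2)) (h4 : (1 / 4 : ℝ) ∉ J) :
    IsConnected {x | x ∈ halfOpenCube ∧ ricciFun x < 0 ∧ mean x ∈ J} := by
  have hdiag : ∀ m ∈ J, (fun _ => m) ∈ {x | x ∈ halfOpenCube ∧ ricciFun x < 0 ∧ mean x ∈ J} := by
    intro m hm
    refine ⟨const_mem_halfOpenCube (hJs hm),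
      ricciFun_const_neg (hJs hm).1 fun h => h4 (h ▸ hm), ?_⟩
    have : mean (fun _ => m) = m := by simp only [mean]; ring
    rwa [this]
  obtain ⟨m₀, hm₀⟩ := hne
  refine ⟨⟨_, hdiag m₀ hm₀⟩, isPreconnected_of_forall (fun _ => m₀) ?_⟩
  rintro y ⟨hy, hneg, hyJ⟩
  refine ⟨(fun m : ℝ => (fun _ : Fin 3 => m)) '' J ∪
    (fun ρ : ℝ => axisPoint (mean y) ρ (dev y)) '' Set.Icc 0 1, ?_, Or.inl ⟨m₀, hm₀, rfl⟩,
    Or.inr ⟨1, ⟨zero_le_one, le_rfl⟩, axisPoint_mean_dev y⟩, ?_⟩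
  · rintro _ (⟨m, hm, rfl⟩ | ⟨ρ, hρ, rfl⟩)
    · exact hdiag m hm
    · have hmem := axisPoint_mem_halfOpenCube hy hρ.1 hρ.2 le_rfl
      simp only [one_mul, add_sub_cancel] at hmem
      refine ⟨hmem, ?_, by dsimp only; rwa [mean_axisPoint (dev_sum y)]⟩
      by_cases hd : dev y = 0
      · simp only [hd, axisPoint_zero]
        exact (hdiag _ hyJ).2.1
      · by_contra! hcon
        rcases hρ.2.lt_or_eq with h1 | h1
        · have h := ricciFun_pos_of_lt (dev_sum y) hd hρ.1 h1 (by rwa [axisPoint_mean_dev]) hcon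
          rw [axisPoint_mean_dev] at h
          linarith
        · rw [h1, axisPoint_mean_dev] at hcon
          linarith
  · refine IsPreconnected.union (fun _ => mean y) ⟨mean y, hyJ, rfl⟩
      ⟨0, ⟨le_rfl, zero_le_one⟩, axisPoint_zero_left _ _⟩ (hJ.image _ ?_)
      (isPreconnected_Icc.image _ ?_)
    · exact Continuous.continuousOn (by fun_prop)
    · exact ((continuous_axisPoint (dev y)).comp (by fun_prop : Continuous fun ρ : ℝ =>
        (mean y, ρ))).continuousOn

/-- A plane vector as a displacement orthogonal to the diagonal. -/
def planeVec (w : ℝ × ℝ) : Fin 3 → ℝ := ![w.1, w.2, -w.1 - w.2]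

/-- A scale at which displacements by `planeVec` stay near the diagonal. -/
noncomputable def planeScale (w : ℝ × ℝ) : ℝ := 1 / (8 * (1 + ‖w‖))

theorem planeScale_pos (w : ℝ × ℝ) : 0 < planeScale w := by
  unfold planeScale; positivity

theorem planeVec_sum (w : ℝ × ℝ) : planeVec w 0 + planeVec w 1 + planeVec w 2 = 0 := by
  simp [planeVec]

theorem axisPoint_planeVec_mem (w : ℝ × ℝ) :
    axisPoint (1 / 4) (planeScale w) (planeVec w) ∈ halfOpenCube := by
  have h1 : |w.1| ≤ ‖w‖ := norm_fst_le w
  have h2 : |w.2| ≤ ‖w‖ := norm_snd_le w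
  have hb : ∀ i, |planeVec w i| ≤ 2 * ‖w‖ := by
    intro i
    fin_cases i
    · simp [planeVec]; linarith [norm_nonneg w]
    · simp [planeVec]; linarith [norm_nonneg w]
    · have := abs_sub (-w.1) w.2
      rw [abs_neg] at this
      simp only [planeVec]
      exact this.trans (by linarith)
  intro i
  have h3 : |planeScale w * planeVec w i| < 1 / 4 := by
    rw [abs_mul, abs_of_pos (planeScale_pos w)]
    calc planeScale w * |planeVec w i| ≤ planeScale w * (2 * ‖w‖) := by
          gcongr
          · exact (planeScale_pos w).le
          · exact hb i
      _ < 1 / 4 := by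
          unfold planeScale
          rw [div_mul_eq_mul_div, div_lt_iff₀ (by positivity)]
          linarith [norm_nonneg w]
  have h4 := abs_lt.1 h3
  exact ⟨by simp only [axisPoint]; linarith, by simp only [axisPoint]; linarith⟩

theorem continuous_axisPoint_planeVec :
    Continuous fun w : ℝ × ℝ => axisPoint (1 / 4) (planeScale w) (planeVec w) := by
  have hs : Continuous planeScale := by
    unfold planeScale
    refine continuous_const.div (by fun_prop) fun w => ?_
    have := norm_nonneg w
    positivity
  refine continuous_pi fun i => ?_
  have hv : Continuous fun w => planeVec w i := by
    fin_cases i <;> simp [planeVec] <;> fun_prop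
  exact continuous_const.add (hs.mul hv)

/-- The image of the punctured plane is a connected positive core in the plane of mean 1/4. Every
positive point is joined to it by a segment. -/
theorem isConnected_pos_region : IsConnected {x | x ∈ halfOpenCube ∧ 0 < ricciFun x} := by
  set S := (fun w : ℝ × ℝ => axisPoint (1 / 4) (planeScale w) (planeVec w)) '' {0}ᶜ with hS
  have hSconn : IsConnected S := by
    refine (isConnected_compl_singleton_of_one_lt_rank ?_ 0).image _
      continuous_axisPoint_planeVec.continuousOn
    rw [rank_prod', Module.rank_self]
    norm_num
  have hSsub : S ⊆ {x | x ∈ halfOpenCube ∧ 0 < ricciFun x} := by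
    rintro _ ⟨w, hw, rfl⟩
    refine ⟨axisPoint_planeVec_mem w, ricciFun_pos_of_lt (ρ := 0) (planeVec_sum w) ?_ le_rfl
      (planeScale_pos w) (axisPoint_planeVec_mem w)
      (by rw [axisPoint_zero_left, ricciFun_quarter])⟩
    intro h0
    apply hw
    have e1 : w.1 = 0 := congrFun h0 0
    have e2 : w.2 = 0 := congrFun h0 1
    exact Prod.ext e1 e2
  obtain ⟨x₀, hx₀⟩ := hSconn.nonempty
  refine ⟨⟨x₀, hSsub hx₀⟩, isPreconnected_of_forall x₀ ?_⟩
  rintro y ⟨hy, hpos⟩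
  have hd : dev y ≠ 0 := by
    intro h
    rw [eq_const_of_dev_eq_zero h] at hpos
    exact absurd hpos (not_lt.2 (ricciFun_const_nonpos _))
  set w : ℝ × ℝ := (dev y 0, dev y 1) with hw
  have hwd : planeVec w = dev y := by
    ext i
    fin_cases i
    · rfl
    · rfl
    · have := dev_sum y
      simp [planeVec, hw]
      linarith
  have hw0 : w ≠ 0 := by
    intro h
    apply hd
    rw [← hwd, h]
    ext i
    fin_cases i <;> simp [planeVec]
  set ρ₀ := planeScale w with hρ₀
  have hρpos : 0 < ρ₀ := planeScale_pos w
  have hbase : axisPoint (1 / 4) ρ₀ (dev y) ∈ S := ⟨w, hw0, by rw [← hwd]⟩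
  -- The radius exceeds `τ` for `τ < 1`, so the segment runs outside the straight contraction, where
  -- Q ≥ 0, and Q is strictly positive on it.
  refine ⟨S ∪ (fun τ : ℝ => axisPoint (1 / 4 + τ * (mean y - 1 / 4)) (ρ₀ + (1 - ρ₀) * τ) (dev y)) ''
    Set.Icc 0 1, ?_, Or.inl hx₀, Or.inr ⟨1, ⟨zero_le_one, le_rfl⟩, ?_⟩, ?_⟩
  · rintro x (hx | ⟨τ, hτ, rfl⟩)
    · exact hSsub hx
    · have hmem : axisPoint (1 / 4 + τ * (mean y - 1 / 4)) (ρ₀ + (1 - ρ₀) * τ) (dev y) ∈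
          halfOpenCube := by
        have h := convex_halfOpenCube (hSsub hbase).1 hy (by linarith [hτ.2] : 0 ≤ 1 - τ) hτ.1
          (by ring)
        convert h using 1
        ext i
        simp only [axisPoint, dev, Pi.add_apply, Pi.smul_apply, smul_eq_mul]
        ring
      refine ⟨hmem, ?_⟩
      rcases hτ.2.lt_or_eq with h1 | h1
      · refine ricciFun_pos_of_lt (dev_sum y) hd hτ.1 ?_ hmem
          (ricciFun_nonneg_toward_quarter hy hτ.1 hτ.2 hpos.le)
        have := mul_pos hρpos (sub_pos.2 h1)
        linarith
      · simp only [h1, one_mul, add_sub_cancel, mul_one, axisPoint_mean_dev]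
        exact hpos
  · simp only [one_mul, add_sub_cancel, mul_one, axisPoint_mean_dev]
  · refine IsPreconnected.union (axisPoint (1 / 4) ρ₀ (dev y)) hbase
      ⟨0, ⟨le_rfl, zero_le_one⟩, by simp⟩ hSconn.isPreconnected (isPreconnected_Icc.image _ ?_)
    exact ((continuous_axisPoint (dev y)).comp (by fun_prop : Continuous fun τ : ℝ =>
      (1 / 4 + τ * (mean y - 1 / 4), ρ₀ + (1 - ρ₀) * τ))).continuousOn

theorem isConnected_zero_region : IsConnected {x | x ∈ halfOpenCube ∧ ricciFun x = 0} := by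
  have hcen : (fun _ => 1 / 4) ∈ {x | x ∈ halfOpenCube ∧ ricciFun x = 0} :=
    ⟨const_mem_halfOpenCube (by norm_num), ricciFun_quarter⟩
  refine ⟨⟨_, hcen⟩, isPreconnected_of_forall (fun _ => 1 / 4) ?_⟩
  rintro y ⟨hy, hy0⟩
  have hm := mean_mem hy
  by_cases hd : dev y = 0
  · have hy' : y = fun _ => 1 / 4 := by
      have h1 := eq_const_of_dev_eq_zero hd
      by_cases h4 : mean y = 1 / 4
      · rw [h1, h4]
      · have h2 := ricciFun_const_neg hm.1 h4
        rw [← h1, hy0] at h2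
        exact absurd h2 (lt_irrefl _)
    exact ⟨{fun _ => 1 / 4}, by simpa using hcen, rfl, hy', isPreconnected_singleton⟩
  set g : ℝ × ℝ → (Fin 3 → ℝ) := fun p =>
    axisPoint (1 / 4 + p.1 * (mean y - 1 / 4)) p.2 (dev y) with hg
  have hgc : Continuous g := (continuous_axisPoint (dev y)).comp
    (by fun_prop : Continuous fun p : ℝ × ℝ => (1 / 4 + p.1 * (mean y - 1 / 4), p.2))
  have hqc : Continuous fun p => ricciFun (g p) := continuous_ricciFun.comp hgc
  -- Over each `τ` the sign of Q changes from `≤ 0` at `ρ = 0` to `≥ 0` at `ρ = τ`, and the zero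
  -- between is unique. So `Z` is a compact graph over [0, 1], and continuity of the height comes
  -- for free from compactness.
  set Z : Set (ℝ × ℝ) := {p | 0 ≤ p.2 ∧ p.2 ≤ p.1 ∧ p.1 ≤ 1 ∧ ricciFun (g p) = 0} with hZ
  have hZmem : ∀ p ∈ Z, g p ∈ halfOpenCube := fun p hp =>
    axisPoint_mem_halfOpenCube hy hp.1 hp.2.1 hp.2.2.1
  have hZcomp : IsCompact Z := by
    refine (isCompact_Icc.prod isCompact_Icc : IsCompact (Set.Icc (0 : ℝ) 1 ×ˢ
      Set.Icc (0 : ℝ) 1)).of_isClosed_subset ?_ fun p hp => ?_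
    · exact (isClosed_le continuous_const continuous_snd).inter
        ((isClosed_le continuous_snd continuous_fst).inter
        ((isClosed_le continuous_fst continuous_const).inter (isClosed_eq hqc continuous_const)))
    · exact ⟨⟨hp.1.trans hp.2.1, hp.2.2.1⟩, ⟨hp.1, hp.2.1.trans hp.2.2.1⟩⟩
  have hunique : ∀ τ ρ ρ', (τ, ρ) ∈ Z → (τ, ρ') ∈ Z → ¬ρ < ρ' := by
    intro τ ρ ρ' h h' hlt
    have := ricciFun_pos_of_lt (dev_sum y) hd h.1 hlt (hZmem _ h') h.2.2.2.ge
    exact this.ne' h'.2.2.2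
  have hZconn : IsPreconnected Z := by
    have : CompactSpace Z := isCompact_iff_compactSpace.1 hZcomp
    let f : Z → Set.Icc (0 : ℝ) 1 := fun p => ⟨p.1.1, p.2.1.trans p.2.2.1, p.2.2.2.1⟩
    have hf : Continuous f := (continuous_fst.comp continuous_subtype_val).subtype_mk _
    have hbij : Function.Bijective f := by
      constructor
      · rintro ⟨⟨τ, ρ⟩, hp⟩ ⟨⟨τ', ρ'⟩, hp'⟩ h
        have h1 : τ = τ' := congrArg Subtype.val h
        subst h1
        have h2 : ρ = ρ' :=
          le_antisymm (not_lt.1 (hunique _ _ _ hp' hp)) (not_lt.1 (hunique _ _ _ hp hp'))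
        subst h2
        rfl
      · rintro ⟨τ, hτ⟩
        have hc : ContinuousOn (fun ρ => ricciFun (g (τ, ρ))) (Set.Icc 0 τ) :=
          (hqc.comp (by fun_prop : Continuous fun ρ : ℝ => (τ, ρ))).continuousOn
        have h0 : ricciFun (g (τ, 0)) ≤ 0 := by
          simp only [hg, axisPoint_zero_left]
          exact ricciFun_const_nonpos _
        have h1 : 0 ≤ ricciFun (g (τ, τ)) :=
          ricciFun_nonneg_toward_quarter hy hτ.1 hτ.2 hy0.ge
        obtain ⟨ρ, hρ, hρ0⟩ := intermediate_value_Icc hτ.1 hc (show (0 : ℝ) ∈ _ from ⟨h0, h1⟩)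
        exact ⟨⟨(τ, ρ), hρ.1, hρ.2, hτ.2, hρ0⟩, rfl⟩
    let e : Z ≃ₜ Set.Icc (0 : ℝ) 1 :=
      Continuous.homeoOfEquivCompactToT2 (f := Equiv.ofBijective f hbij) hf
    have huniv : IsPreconnected (Set.univ : Set Z) := by
      have : PreconnectedSpace (Set.Icc (0 : ℝ) 1) := Subtype.preconnectedSpace isPreconnected_Icc
      rw [← e.isPreconnected_image, Set.image_univ, e.surjective.range_eq]
      exact isPreconnected_univ
    have := huniv.image Subtype.val continuous_subtype_val.continuousOn
    rwa [Subtype.coe_image_univ] at this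
  refine ⟨g '' Z, ?_, ⟨(0, 0), ⟨le_rfl, le_rfl, zero_le_one, ?_⟩, ?_⟩,
    ⟨(1, 1), ⟨zero_le_one, le_rfl, le_rfl, ?_⟩, ?_⟩, hZconn.image _ hgc.continuousOn⟩
  · rintro _ ⟨p, hp, rfl⟩
    exact ⟨hZmem p hp, hp.2.2.2⟩
  · simp only [hg, axisPoint_zero_left, zero_mul, add_zero, ricciFun_quarter]
  · simp only [hg, axisPoint_zero_left, zero_mul, add_zero]
  · simp only [hg, one_mul, add_sub_cancel, axisPoint_mean_dev, hy0]
  · simp only [hg, one_mul, add_sub_cancel, axisPoint_mean_dev]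

theorem corollary1 :
    IsConnected (halfOpenCube ∩ ricciOmega) ∧
      Nat.card (ConnectedComponents ↥(halfOpenCube \ ricciOmega)) = 3 := by
  refine ⟨isConnected_zero_region, ?_⟩
  let R : Fin 3 → Set (Fin 3 → ℝ) := ![{x | x ∈ halfOpenCube ∧ ricciFun x < 0 ∧
    mean x ∈ Set.Ioo 0 (1 / 4)}, {x | x ∈ halfOpenCube ∧ ricciFun x < 0 ∧
    mean x ∈ Set.Ioc (1 / 4) (1 / 2)}, {x | x ∈ halfOpenCube ∧ 0 < ricciFun x}]
  have hRconn : ∀ i, IsConnected (R i) := by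
    intro i
    fin_cases i
    · exact isConnected_neg_region isPreconnected_Ioo ⟨1 / 8, by norm_num⟩
        (fun x hx => ⟨hx.1, by linarith [hx.2]⟩) (by simp)
    · exact isConnected_neg_region isPreconnected_Ioc ⟨1 / 2, by norm_num⟩
        (fun x hx => ⟨by linarith [hx.1], hx.2⟩) (by simp)
    · exact isConnected_pos_region
  have hRsub : ∀ i, R i ⊆ halfOpenCube \ ricciOmega := by
    intro i x hx
    fin_cases i
    · exact ⟨hx.1, fun h => hx.2.1.ne h⟩
    · exact ⟨hx.1, fun h => hx.2.1.ne h⟩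
    · exact ⟨hx.1, fun h => hx.2.ne' h⟩
  have hq : Continuous fun x : ↥(halfOpenCube \ ricciOmega) => ricciFun x.1 :=
    continuous_ricciFun.comp continuous_subtype_val
  have hm : Continuous fun x : ↥(halfOpenCube \ ricciOmega) => mean x.1 :=
    continuous_mean.comp continuous_subtype_val
  refine natCard_connectedComponents_of_partition (fun i => Subtype.val ⁻¹' R i) ?_ ?_ ?_ ?_
  · intro i
    fin_cases i
    · convert (isOpen_lt hq continuous_const).inter (isOpen_lt hm continuous_const) using 1
      ext x
      exact ⟨fun h => ⟨h.2.1, h.2.2.2⟩, fun h => ⟨x.2.1, h.1, (mean_mem x.2.1).1, h.2⟩⟩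
    · convert (isOpen_lt hq continuous_const).inter (isOpen_lt continuous_const hm) using 1
      ext x
      exact ⟨fun h => ⟨h.2.1, h.2.2.1⟩, fun h => ⟨x.2.1, h.1, h.2, (mean_mem x.2.1).2⟩⟩
    · convert isOpen_lt continuous_const hq using 1
      ext x
      exact ⟨fun h => h.2, fun h => ⟨x.2.1, h⟩⟩
  · rintro ⟨x, hx, hne⟩
    rcases lt_trichotomy (ricciFun x) 0 with h | h | h
    · rcases lt_trichotomy (mean x) (1 / 4) with h' | h' | h'
      · exact ⟨0, hx, h, (mean_mem hx).1, h'⟩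
      -- No negative point has mean 1/4, so the two half-spaces cover the negative set.
      · exact absurd h (not_lt.2 (nonneg_of_mean_eq_quarter hx h'))
      · exact ⟨1, hx, h, h', (mean_mem hx).2⟩
    · exact absurd h hne
    · exact ⟨2, hx, h⟩
  · rintro i j ⟨x, hx⟩ hi hj
    fin_cases i <;> fin_cases j <;> first
      | rfl
      | exact absurd hi.2.2.2 (not_lt.2 hj.2.2.1.le)
      | exact absurd hj.2.2.2 (not_lt.2 hi.2.2.1.le)
      | exact absurd hi.2.1 (not_lt.2 hj.2.le)
      | exact absurd hj.2.1 (not_lt.2 hi.2.le)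
  · intro i
    have himg : Subtype.val '' (Subtype.val ⁻¹' R i : Set ↥(halfOpenCube \ ricciOmega)) = R i := by
      rw [Subtype.image_preimage_coe, Set.inter_eq_right]
      exact hRsub i
    obtain ⟨x, hx⟩ := (hRconn i).nonempty
    refine ⟨⟨⟨x, hRsub i hx⟩, hx⟩, ?_⟩
    rw [← Topology.IsInducing.subtypeVal.isPreconnected_image, himg]
    exact (hRconn i).isPreconnected
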